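/- Let $\Lambda=\mathbb{Z}\lambda_1+\mathbb{Z}\lambda_2\subset\mathbb{C}$ be a lattice ($\lambda_1,\lambda_2$ linearly independent over $\mathbb{R}$), let $\mathcal{K}_\Lambda$ be the field of elliptic functions, i.e. $\Lambda$-periodic meromorphic functions on $\mathbb{C}$, fix $s\in\mathbb{C}\setminus\mathbb{Q}\Lambda$, and put $\tau(f)(z)=f(z+s)$. Let $$\zeta(z)=\frac1z+\sum_{0\ne\lambda\in\Lambda}\Big(\frac1{z-\lambda}+\frac1\lambda+\frac{z}{\lambda^2}\Big)$$ be the Weierstrass $\zeta$-function of $\Lambda$. For $f\in\mathcal{K}_\Lambda$, $\alpha\in\mathbb{C}$ and $j\ge 1$ let $c_j(f,\alpha)$ be the coefficient of $(z-\alpha)^{-j}$ in the Laurent expansion of $f$ at $\alpha$. For an orbit $\omega\in\mathbb{C}/(\Lambda\oplus\mathbb{Z}s)$ with representative $q_\omega$, the analytic orbital residue of $f$ at $\omega$ of order $j\geq 1$ is $$\mathrm{ores}(f,\omega,j)=\sum_{n\in\mathbb{Z}}c_j(f,q_\omega+ns),$$ which does not depend on the choice of $q_\omega$. An analytic pinning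 $\mathcal{R}$ is a choice of a representative $q_\omega$ of each orbit $\omega\in\mathbb{C}/(\Lambda\oplus\mathbb{Z}s)$, such that the representative of the orbit of $0$ is $0$. Relative to $\mathcal{R}$, the function $f$ has a unique expansion $$f(z)=C_{\mathcal{R}}(f)+\sum_{q\in\mathcal{R}}\sum_{n\in\mathbb{Z}}\sum_{j\ge1}\frac{(-1)^{j-1}c_j(f,q+ns)}{(j-1)!}\,\zeta^{(j-1)}(z-q-ns)$$ with a constant $C_{\mathcal{R}}(f)\in\mathbb{C}$, and the analytic panorbital residues of $f$ are $$\mathrm{pano}_{\mathcal{R}}(f,0)=C_{\mathcal{R}}(f),\qquad \mathrm{pano}_{\mathcal{R}}(f,1)=\sum_{q\in\mathcal{R}}\sum_{n\in\mathbb{Z}}n\,c_1(f,q+ns).$$ Let $f\in\mathcal{K}_\Lambda$ and let $\mathcal{R}$ be an analytic pinning. The following are equivalent: (i) there exist $g\in\mathcal{K}_\Lambda$ and constants $a,b\in\mathbb{C}$ such that $f-(\tau(g)-g)=a+b\,(\zeta(z+s)-\zeta(z))$; (ii) $\mathrm{ores}(f,\omega,j)=0$ for all orbits $\omega\in\mathbb{C}/(\Lambda\oplus\mathbb{Z}s)$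 and all $j\ge1$. Moreover, whenever $g$, $a$, $b$ are as in (i), one has $a=\mathrm{pano}_{\mathcal{R}}(f,0)$ and $b=-\mathrm{pano}_{\mathcal{R}}(f,1)$. Equivalently in terms of $\zeta(z-s)$: if (ii) holds, then there is $g\in\mathcal{K}_\Lambda$ such that $$f-(\tau(g)-g)=\mathrm{pano}_{\mathcal{R}}(f,0)+\mathrm{pano}_{\mathcal{R}}(f,1)\,(\zeta(z-s)-\zeta(z)).$$ -/

import Mathlib

open Filter Topology
open scoped Nat

noncomputable section

namespace EllipticSummability

/-- `f` is an elliptic function for the lattice of `L`: meromorphic on the complex plane and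
periodic with respect to every lattice vector. Values at poles (and at removable singularities)
are irrelevant: identities between elliptic functions are stated off a discrete closed set, that
is, eventually along `codiscrete ℂ`. -/
def IsElliptic (L : PeriodPair) (f : ℂ → ℂ) : Prop :=
  Meromorphic f ∧ ∀ l ∈ L.lattice, ∀ z : ℂ, f (z + l) = f z

/-- The shift automorphism `τ`. -/
def tau (s : ℂ) (f : ℂ → ℂ) : ℂ → ℂ := fun z => f (z + s)

/-- The Weierstrass zeta function
`ζ(z) = 1 / z + ∑ (1 / (z - l) + 1 / l + z / l ^ 2)`, the sum over nonzero lattice vectors.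
Since division by zero is zero, the summand below at `l = 0` is exactly `1 / z`. -/
def weierstrassZeta (L : PeriodPair) (z : ℂ) : ℂ :=
  ∑' l : L.lattice, (1 / (z - l) + 1 / (l : ℂ) + z / (l : ℂ) ^ 2)

open Classical in
/-- The coefficient of `(z - α) ^ (-j)` in the Laurent expansion of `f` at `α`, for a function
meromorphic at `α` (and `0` otherwise). It is the Taylor coefficient of order `n - j` of
`(z - α) ^ n * f z`, where `n` is such that this product is analytic at `α`. -/
def polarCoeff (f : ℂ → ℂ) (α : ℂ) (j : ℕ) : ℂ :=
  if h : ∃ n : ℕ, AnalyticAt ℂ (fun z => (z - α) ^ n * f z) α then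
    if j ≤ h.choose then
      iteratedDeriv (h.choose - j) (fun z => (z - α) ^ h.choose * f z) α / ((h.choose - j)! : ℂ)
    else 0
  else 0

/-- The group `Λ + ℤ s`. -/
def orbitGroup (L : PeriodPair) (s : ℂ) : AddSubgroup ℂ :=
  L.lattice.toAddSubgroup ⊔ AddSubgroup.zmultiples s

/-- The set of orbits `ℂ / (Λ + ℤ s)`. -/
abbrev Orbit (L : PeriodPair) (s : ℂ) : Type := ℂ ⧸ orbitGroup L s

/-- An analytic pinning: a representative of each orbit, the one of the orbit of `0` being `0`. -/
structure AnalyticPinning (L : PeriodPair) (s : ℂ) where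
  /-- the chosen representative of an orbit -/
  rep : Orbit L s → ℂ
  mk_rep : ∀ ω : Orbit L s, (QuotientAddGroup.mk (rep ω) : Orbit L s) = ω
  rep_zero : rep 0 = 0

/-- The analytic orbital residue of `f` of order `j` at the orbit `ω`, computed at an arbitrarily
chosen representative of `ω` (for elliptic `f` the choice does not matter). -/
def orbitalResidue (L : PeriodPair) (s : ℂ) (f : ℂ → ℂ) (ω : Orbit L s) (j : ℕ) : ℂ :=
  ∑ᶠ n : ℤ, polarCoeff f (Quotient.out ω + n * s) j

/-- The non-constant part of the zeta expansion of `f` relative to a pinning; the summation index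
`j` here is one less than the order of the pole. -/
def pinnedZetaSum (L : PeriodPair) (s : ℂ) (R : AnalyticPinning L s) (f : ℂ → ℂ) (z : ℂ) : ℂ :=
  ∑ᶠ (ω : Orbit L s) (n : ℤ) (j : ℕ),
    polarCoeff f (R.rep ω + n * s) (j + 1) * (-1) ^ j / (j ! : ℂ) *
      iteratedDeriv j (weierstrassZeta L) (z - R.rep ω - n * s)

open Classical in
/-- The panorbital residue of order `0`: the constant term `C` of the zeta expansion of `f`
relative to the pinning, i.e. the constant with `f = C + pinnedZetaSum`. -/
def panorbitalResidueZero (L : PeriodPair) (s : ℂ) (R : AnalyticPinning L s) (f : ℂ → ℂ) : ℂ :=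
  if h : ∃ C : ℂ, f =ᶠ[codiscrete ℂ] fun z => C + pinnedZetaSum L s R f z then h.choose else 0

/-- The panorbital residue of order `1`. -/
def panorbitalResidueOne (L : PeriodPair) (s : ℂ) (R : AnalyticPinning L s) (f : ℂ → ℂ) : ℂ :=
  ∑ᶠ (ω : Orbit L s) (n : ℤ), (n : ℂ) * polarCoeff f (R.rep ω + n * s) 1

end EllipticSummability

end

open EllipticSummability

/-! Up to a constant, an elliptic function is its finite table of polar coefficients `polarData`,
indexed by orbit, integer `n` and pole order. It equals `C + zetaSum` of that table off a discrete
set, and the sum of its residues is zero (`exists_eq_const_add_zetaSum`). Conversely, a zeta sum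
with total residue zero is elliptic after adjusting values on a discrete set (`zetaSum_add_coe`,
`exists_isElliptic_eventuallyEq`). The problem thus becomes linear algebra on finitely supported
tables, where `τ` acts as `shiftIndex`, moving `n` to `n - 1`.

The term `b * (ζ(z + s) - ζ(z))` is also a shift difference, that of `b * ζ`, whose table has total
residue `b`. So (i) makes the table of `f` equal to `shiftIndex x - x` with `x` the table of `g + b
* ζ`, of total residue `b`; the constant of `g` cancels, leaving `a` as the constant of `f`. A table
is a shift difference exactly when its sums along orbits vanish (`orbitSum_shiftIndex`,
`exists_shiftIndex_sub_eq`), which is (ii). The first moment of `shiftIndex x - x` is minus the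
total residue of `x` (`firstMoment_shiftIndex_sub`), so `b` is minus the first panorbital residue.

The analytic core is `not_forall_quasiPeriod_eq_mul`: no `ζ(z) - a z` is elliptic. It forces
residues to sum to zero in the zeta expansion. -/

namespace EllipticSummability

/-! ### Principal parts and polar coefficients. -/

section PrincipalPart

theorem iteratedDeriv_sub_const_pow_self (α : ℂ) (p m : ℕ) :
    iteratedDeriv m (fun z : ℂ => (z - α) ^ p) α = if m = p then (p ! : ℂ) else 0 := by
  rw [iteratedDeriv_comp_sub_const m (fun z : ℂ => z ^ p) α]
  simp only [sub_self, iteratedDeriv_fun_pow_zero]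
  split_ifs <;> simp_all

/-- Multiplication by `(z - α) ^ p` shifts Taylor coefficients. -/
theorem taylorCoeff_sub_pow_mul {F : ℂ → ℂ} {α : ℂ} (hF : AnalyticAt ℂ F α) (p m : ℕ) :
    iteratedDeriv m (fun z => (z - α) ^ p * F z) α / (m ! : ℂ) =
      if p ≤ m then iteratedDeriv (m - p) F α / ((m - p)! : ℂ) else 0 := by
  rw [iteratedDeriv_fun_mul (by fun_prop) hF.contDiffAt]
  simp only [iteratedDeriv_sub_const_pow_self, mul_ite, ite_mul, mul_zero, zero_mul]
  rw [Finset.sum_ite_eq']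
  simp only [Finset.mem_range, Order.lt_add_one_iff]
  split_ifs with h
  · rw [Nat.cast_choose ℂ h]
    have h1 : (m ! : ℂ) ≠ 0 := by exact_mod_cast m.factorial_ne_zero
    have h2 : (p ! : ℂ) ≠ 0 := by exact_mod_cast p.factorial_ne_zero
    have h3 : ((m - p)! : ℂ) ≠ 0 := by exact_mod_cast (m - p).factorial_ne_zero
    field_simp
  · simp

/-- `f` has the principal part `∑ k, c k / (z - α) ^ (k + 1)` at `α`. -/
def HasPrincipalPart (f : ℂ → ℂ) (α : ℂ) (c : ℕ →₀ ℂ) : Prop :=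
  ∃ h : ℂ → ℂ, AnalyticAt ℂ h α ∧
    f =ᶠ[𝓝[≠] α] fun z => (c.sum fun k a => a / (z - α) ^ (k + 1)) + h z

variable {f g : ℂ → ℂ} {α : ℂ} {c d : ℕ →₀ ℂ}

theorem _root_.AnalyticAt.hasPrincipalPart_zero (hf : AnalyticAt ℂ f α) :
    HasPrincipalPart f α 0 :=
  ⟨f, hf, by simp [EventuallyEq.refl]⟩

theorem HasPrincipalPart.congr (hf : HasPrincipalPart f α c) (hfg : g =ᶠ[𝓝[≠] α] f) :
    HasPrincipalPart g α c :=
  let ⟨h, hh, e⟩ := hf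
  ⟨h, hh, hfg.trans e⟩

theorem HasPrincipalPart.add (hf : HasPrincipalPart f α c) (hg : HasPrincipalPart g α d) :
    HasPrincipalPart (f + g) α (c + d) := by
  obtain ⟨h, hh, e⟩ := hf
  obtain ⟨k, hk, e'⟩ := hg
  refine ⟨h + k, hh.add hk, (e.add e').trans (.of_eq ?_)⟩
  ext z
  rw [Finsupp.sum_add_index' (by simp) (by intros; ring)]
  simp only [Pi.add_apply]
  ring

theorem HasPrincipalPart.const_smul (hf : HasPrincipalPart f α c) (a : ℂ) :
    HasPrincipalPart (a • f) α (a • c) := by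
  obtain ⟨h, hh, e⟩ := hf
  refine ⟨a • h, hh.const_smul, (e.const_smul a).trans (.of_eq ?_)⟩
  ext z
  rw [Finsupp.sum_smul_index' (by simp)]
  simp only [Pi.smul_apply, smul_eq_mul, mul_add, Finsupp.mul_sum, mul_div_assoc]

theorem HasPrincipalPart.sub (hf : HasPrincipalPart f α c) (hg : HasPrincipalPart g α d) :
    HasPrincipalPart (f - g) α (c - d) := by
  simpa [sub_eq_add_neg] using hf.add (hg.const_smul (-1))

theorem hasPrincipalPart_single (α : ℂ) (k : ℕ) (a : ℂ) :
    HasPrincipalPart (fun z => a / (z - α) ^ (k + 1)) α (Finsupp.single k a) :=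
  ⟨0, analyticAt_const, by simp [EventuallyEq.refl]⟩

theorem HasPrincipalPart.comp_add_const (s : ℂ) (hf : HasPrincipalPart f (α + s) c) :
    HasPrincipalPart (fun z => f (z + s)) α c := by
  obtain ⟨h, hh, e⟩ := hf
  refine ⟨fun z => h (z + s), hh.fun_comp_of_eq (by fun_prop) rfl, ?_⟩
  have : Tendsto (fun z : ℂ => z + s) (𝓝[≠] α) (𝓝[≠] (α + s)) := map_add_right_nhdsNE.le
  filter_upwards [this.eventually e] with z hz
  simp only [hz, add_sub_add_right_eq_sub]

theorem HasPrincipalPart.meromorphicAt (hf : HasPrincipalPart f α c) : MeromorphicAt f α := by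
  obtain ⟨h, hh, e⟩ := hf
  refine MeromorphicAt.congr ?_ e.symm
  refine MeromorphicAt.fun_add ?_ hh.meromorphicAt
  refine MeromorphicAt.fun_sum fun i _ => ?_
  fun_prop

/-- Writing `F z = F α + (z - α) * dslope F α z` splits off the most singular term and leaves a
quotient with denominator of degree one less. -/
theorem hasPrincipalPart_div_pow (n : ℕ) :
    ∀ {F : ℂ → ℂ}, AnalyticAt ℂ F α → ∃ c, HasPrincipalPart (fun z => F z / (z - α) ^ n) α c := by
  induction n with
  | zero => exact fun hF => ⟨0, by simpa using hF.hasPrincipalPart_zero⟩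
  | succ n ih =>
    intro F hF
    obtain ⟨p, hp⟩ := hF
    obtain ⟨c, hc⟩ := ih (F := dslope F α) ⟨_, hp.has_fpower_series_dslope_fslope⟩
    refine ⟨_, ((hasPrincipalPart_single α n (F α)).add hc).congr ?_⟩
    filter_upwards [self_mem_nhdsWithin] with z hz
    have hz : z - α ≠ 0 := sub_ne_zero.2 hz
    have := sub_smul_dslope F α z
    rw [smul_eq_mul] at this
    simp only [Pi.add_apply]
    rw [eq_sub_iff_add_eq.1 this |>.symm]
    field_simp
    ring

theorem _root_.MeromorphicAt.exists_hasPrincipalPart (hf : MeromorphicAt f α) :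
    ∃ c, HasPrincipalPart f α c := by
  obtain ⟨n, hn⟩ := hf
  obtain ⟨c, hc⟩ := hasPrincipalPart_div_pow n hn
  refine ⟨c, hc.congr ?_⟩
  filter_upwards [self_mem_nhdsWithin] with z hz
  have hz : z - α ≠ 0 := sub_ne_zero.2 hz
  simp only [smul_eq_mul]
  field_simp

/-- Clearing denominators with `(z - α) ^ M` turns the principal part into a polynomial of degree
below `M`, and the analytic remainder starts only in degree `M`. -/
theorem taylorCoeff_sum_sub_pow_add {h : ℂ → ℂ} (hh : AnalyticAt ℂ h α) (c : ℕ →₀ ℂ) {M j : ℕ}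
    (hM : ∀ k ∈ c.support, k + 1 ≤ M) (hj : j + 1 ≤ M) :
    iteratedDeriv (M - (j + 1))
      (fun z => (c.sum fun k a => a * (z - α) ^ (M - (k + 1))) + (z - α) ^ M * h z) α /
        ((M - (j + 1))! : ℂ) = c j := by
  have h1 : ContDiffAt ℂ (M - (j + 1) : ℕ) (fun z => (z - α) ^ M * h z) α :=
    AnalyticAt.contDiffAt (by fun_prop)
  rw [iteratedDeriv_fun_add (by unfold Finsupp.sum; fun_prop) h1, add_div,
    taylorCoeff_sub_pow_mul hh, if_neg (by omega), add_zero]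
  unfold Finsupp.sum
  rw [iteratedDeriv_fun_sum (by intros; fun_prop)]
  have h2 : ∀ k ∈ c.support,
      iteratedDeriv (M - (j + 1)) (fun z : ℂ => c k * (z - α) ^ (M - (k + 1))) α =
        if k = j then c j * ((M - (j + 1))! : ℂ) else 0 := by
    intro k hk
    rw [iteratedDeriv_const_mul _ (by fun_prop), iteratedDeriv_sub_const_pow_self]
    have := hM k hk
    by_cases hkj : k = j
    · simp [hkj]
    · rw [if_neg (by omega), if_neg hkj, mul_zero]
  rw [Finset.sum_congr rfl h2, Finset.sum_ite_eq']
  have h3 : ((M - (j + 1))! : ℂ) ≠ 0 := by exact_mod_cast (M - (j + 1)).factorial_ne_zero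
  split_ifs with hc
  · field_simp
  · simpa using (Finsupp.notMem_support_iff.1 hc).symm

/-- `polarCoeff` uses an arbitrarily chosen clearing exponent `n`. Passing to a larger common
exponent `M` shows that the choice is harmless. -/
theorem HasPrincipalPart.polarCoeff_eq (hf : HasPrincipalPart f α c) (j : ℕ) :
    polarCoeff f α (j + 1) = c j := by
  have hex : ∃ n : ℕ, AnalyticAt ℂ (fun z => (z - α) ^ n * f z) α := hf.meromorphicAt
  obtain ⟨h, hh, e⟩ := hf
  unfold polarCoeff
  rw [dif_pos hex]
  have hF := hex.choose_spec
  set n := hex.choose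
  -- `M` dominates `n`, all pole orders and `j + 1`, so no natural-number subtraction below
  -- truncates.
  set M := n + (c.support.sup id + 1) + (j + 1) with hMdef
  have hM : ∀ k ∈ c.support, k + 1 ≤ M := by
    intro k hk
    have : k ≤ c.support.sup id := Finset.le_sup (f := id) hk
    omega
  have hj : j + 1 ≤ M := by omega
  have key : (fun z => (z - α) ^ (M - n) * ((z - α) ^ n * f z)) =ᶠ[𝓝 α]
      fun z => (c.sum fun k a => a * (z - α) ^ (M - (k + 1))) + (z - α) ^ M * h z := by
    -- Both sides are analytic at `α`, so agreement on the punctured neighbourhood extends to `α`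
    -- itself.
    refine (AnalyticAt.frequently_eq_iff_eventually_eq (by fun_prop) ?_).1 (Eventually.frequently ?_)
    · unfold Finsupp.sum
      fun_prop
    · filter_upwards [e, self_mem_nhdsWithin] with z hz hne
      have hne : z - α ≠ 0 := sub_ne_zero.2 hne
      rw [hz, ← mul_assoc, ← pow_add, show M - n + n = M by omega, mul_add, Finsupp.mul_sum]
      congr 1
      refine Finset.sum_congr rfl fun k hk => ?_
      have : M = M - (k + 1) + (k + 1) := by have := hM k hk; omega
      nth_rw 1 [this]
      rw [pow_add]
      field_simp
  rw [← taylorCoeff_sum_sub_pow_add hh c hM hj, ← key.iteratedDeriv_eq,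
    taylorCoeff_sub_pow_mul hF]
  have h1 : M - n ≤ M - (j + 1) ↔ j + 1 ≤ n := by omega
  simp only [h1]
  split_ifs with h2
  · rw [show M - (j + 1) - (M - n) = n - (j + 1) by omega]
  · rfl

theorem _root_.MeromorphicAt.hasPrincipalPart (hf : MeromorphicAt f α) :
    ∃ c, HasPrincipalPart f α c ∧ ∀ j, c j = polarCoeff f α (j + 1) :=
  let ⟨c, hc⟩ := hf.exists_hasPrincipalPart
  ⟨c, hc, fun j => (hc.polarCoeff_eq j).symm⟩

end PrincipalPart

/-! ### The Weierstrass zeta function, its quasi-periods and its derivatives. -/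

section WeierstrassZeta

variable (L : PeriodPair)

/-- The three terms combine to `z ^ 2 / (l ^ 2 * (z - l))`, which has cubic decay in `l` and is
therefore summable over a planar lattice. -/
theorem norm_zetaSummand_le (r : ℝ) (hr : 0 < r) (z : ℂ) (hz : ‖z‖ < r) (l : ℂ)
    (h : 2 * r ≤ ‖l‖) :
    ‖1 / (z - l) + 1 / l + z / l ^ 2‖ ≤ 2 * r ^ 2 * ‖l‖ ^ (-3 : ℝ) := by
  have hl : 0 < ‖l‖ := by linarith
  have hl0 : l ≠ 0 := norm_pos_iff.1 hl
  have hzl : z - l ≠ 0 := by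
    rw [sub_ne_zero]
    rintro rfl
    linarith
  have h1 : ‖l‖ / 2 ≤ ‖z - l‖ := by
    rw [norm_sub_rev]
    exact .trans (by linarith) (norm_sub_norm_le l z)
  calc
    _ = ‖z ^ 2 / (l ^ 2 * (z - l))‖ := by
      congr 1
      field_simp
      ring
    _ = ‖z‖ ^ 2 / (‖l‖ ^ 2 * ‖z - l‖) := by simp
    _ ≤ r ^ 2 / (‖l‖ ^ 2 * (‖l‖ / 2)) := by gcongr
    _ = 2 * r ^ 2 / ‖l‖ ^ 3 := by field
    _ = _ := by norm_cast

/-- The Weierstrass zeta function without the summand at `l₀`. -/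
noncomputable def zetaExcept (l₀ z : ℂ) : ℂ :=
  ∑' l : L.lattice, if (l : ℂ) = l₀ then 0 else (1 / (z - l) + 1 / (l : ℂ) + z / (l : ℂ) ^ 2)

theorem hasSumLocallyUniformly_zetaExcept (l₀ : ℂ) :
    HasSumLocallyUniformly
      (fun (l : L.lattice) (z : ℂ) =>
        if (l : ℂ) = l₀ then 0 else (1 / (z - l) + 1 / (l : ℂ) + z / (l : ℂ) ^ 2))
      (zetaExcept L l₀) := by
  refine L.hasSumLocallyUniformly_aux (u := fun r l => 2 * r ^ 2 * ‖l‖ ^ (-3 : ℝ)) _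
    (fun _ _ => (ZLattice.summable_norm_rpow _ _ (by simp; norm_num)).mul_left _) fun r hr =>
    Filter.eventually_atTop.mpr ⟨2 * r, ?_⟩
  rintro _ h s hs l rfl
  split_ifs
  · rw [norm_zero]; positivity
  · exact norm_zetaSummand_le r hr s hs l h

theorem differentiableOn_zetaExcept (l₀ : ℂ) :
    DifferentiableOn ℂ (zetaExcept L l₀) (L.lattice \ {l₀})ᶜ := by
  refine (hasSumLocallyUniformly_zetaExcept L l₀).hasSumLocallyUniformlyOn.differentiableOn
    (.of_forall fun s => .fun_sum fun i hi => ?_) L.isOpen_compl_lattice_sdiff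
  split_ifs with h
  · simp
  · refine .add (.add (.div (by fun_prop) (by fun_prop) fun x hx => ?_) (by fun_prop)) (by fun_prop)
    rw [sub_ne_zero]
    rintro rfl
    exact hx ⟨i.2, h⟩

theorem zetaExcept_add (l₀ : L.lattice) (z : ℂ) :
    zetaExcept L l₀ z + (1 / (z - l₀) + 1 / (l₀ : ℂ) + z / (l₀ : ℂ) ^ 2) =
      weierstrassZeta L z := by
  trans zetaExcept L l₀ z + ∑' i : L.lattice,
    if (i : ℂ) = l₀ then (1 / (z - l₀) + 1 / (l₀ : ℂ) + z / (l₀ : ℂ) ^ 2) else 0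
  · simp
  rw [zetaExcept, weierstrassZeta, ← Summable.tsum_add]
  · congr with w; split_ifs <;> simp only [zero_add, add_zero, *]
  · exact ⟨_, (hasSumLocallyUniformly_zetaExcept L l₀).hasSum⟩
  · exact summable_of_hasFiniteSupport ((Set.finite_singleton l₀).subset (by simp))

theorem zetaExcept_of_notMem (l₀ : ℂ) (hl : l₀ ∉ L.lattice) :
    zetaExcept L l₀ = weierstrassZeta L := by
  ext z
  unfold zetaExcept weierstrassZeta
  congr! 2 with l
  rw [if_neg]
  rintro rfl
  exact hl l.2

theorem hasSumLocallyUniformly_weierstrassZeta :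
    HasSumLocallyUniformly
      (fun (l : L.lattice) (z : ℂ) => 1 / (z - l) + 1 / (l : ℂ) + z / (l : ℂ) ^ 2)
      (weierstrassZeta L) := by
  -- A half period is not a lattice point, so excluding it excludes no summand.
  have := hasSumLocallyUniformly_zetaExcept L (L.ω₁ / 2)
  rw [zetaExcept_of_notMem L _ L.ω₁_div_two_notMem_lattice] at this
  convert! this using 3 with l
  rw [if_neg]
  exact fun e => L.ω₁_div_two_notMem_lattice (e ▸ l.2)

theorem differentiableOn_weierstrassZeta :
    DifferentiableOn ℂ (weierstrassZeta L) (L.lattice : Set ℂ)ᶜ := by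
  have := differentiableOn_zetaExcept L (L.ω₁ / 2)
  rw [zetaExcept_of_notMem L _ L.ω₁_div_two_notMem_lattice] at this
  refine this.mono (Set.compl_subset_compl.2 Set.sdiff_subset)

theorem analyticAt_weierstrassZeta {z : ℂ} (hz : z ∉ L.lattice) :
    AnalyticAt ℂ (weierstrassZeta L) z :=
  (differentiableOn_weierstrassZeta L).analyticAt (L.isClosed_lattice.isOpen_compl.mem_nhds hz)

theorem deriv_weierstrassZeta {z : ℂ} (hz : z ∉ L.lattice) :
    deriv (weierstrassZeta L) z = -L.weierstrassP z := by
  have hne : ∀ x ∈ (L.lattice : Set ℂ)ᶜ, ∀ l : L.lattice, x - l ≠ 0 := by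
    intro x hx l e
    exact hx (sub_eq_zero.1 e ▸ l.2)
  refine ((hasSumLocallyUniformly_weierstrassZeta L).tendstoLocallyUniformlyOn.deriv
    (.of_forall fun s => ?_) L.isClosed_lattice.isOpen_compl).unique
      (g := fun z => -L.weierstrassP z) ?_ hz
  · exact .fun_sum fun i hi => .add (.add (.div (by fun_prop) (by fun_prop)
      fun x hx => hne x hx i) (by fun_prop)) (by fun_prop)
  · refine L.hasSumLocallyUniformly_weierstrassP.tendstoLocallyUniformlyOn.neg.congr ?_
    intro s x hx
    simp only [Function.comp_apply, Pi.neg_apply]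
    have hd : ∀ l : L.lattice, HasDerivAt
        (fun z : ℂ => 1 / (z - l) + 1 / (l : ℂ) + z / (l : ℂ) ^ 2)
        (-(1 / (x - l) ^ 2 - 1 / (l : ℂ) ^ 2)) x := by
      intro l
      have h1 := (((hasDerivAt_id x).sub_const (l : ℂ)).inv (hne x hx l)).add_const (1 / (l : ℂ))
      have h2 := h1.add ((hasDerivAt_id x).div_const ((l : ℂ) ^ 2))
      refine (h2.congr_deriv ?_).congr_of_eventuallyEq (.of_eq ?_)
      · simp only [id]
        ring
      · ext; simp
    rw [(HasDerivAt.fun_sum fun i _ => hd i).deriv]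
    simp

theorem weierstrassZeta_neg (z : ℂ) : weierstrassZeta L (-z) = -weierstrassZeta L z := by
  simp only [weierstrassZeta]
  rw [← (Equiv.neg L.lattice).tsum_eq, ← tsum_neg]
  congr with l
  simp only [Equiv.neg_apply, NegMemClass.coe_neg]
  rw [show -z - -(l : ℂ) = -(z - l) by ring, div_neg, div_neg, neg_sq, neg_div]
  ring

theorem isPreconnected_compl_lattice : IsPreconnected (L.lattice : Set ℂ)ᶜ :=
  (Set.Countable.isConnected_compl_of_one_lt_rank (by simp)
    (countable_of_Lindelof_of_discrete (X := L.lattice))).isPreconnected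

/-- The difference has derivative `℘(z) - ℘(z + l) = 0`, and the complement of the lattice is
connected, so one constant serves all `z`. -/
theorem exists_weierstrassZeta_add (l : L.lattice) :
    ∃ η : ℂ, ∀ z ∉ L.lattice, weierstrassZeta L (z + l) = weierstrassZeta L z + η := by
  have hmem : ∀ z ∉ L.lattice, z + l ∉ L.lattice := fun z hz h => hz (by simpa using sub_mem h l.2)
  have hd : ∀ z ∉ L.lattice, HasDerivAt (fun z => weierstrassZeta L (z + l) - weierstrassZeta L z)
      0 z := by
    intro z hz
    have h1 := (analyticAt_weierstrassZeta L hz).differentiableAt.hasDerivAt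
    have h2 := (analyticAt_weierstrassZeta L (hmem z hz)).differentiableAt.hasDerivAt
    refine ((h2.comp_add_const z (l : ℂ)).sub h1).congr_deriv ?_
    rw [deriv_weierstrassZeta L hz, deriv_weierstrassZeta L (hmem z hz), L.weierstrassP_add_coe,
      sub_self]
  obtain ⟨η, hη⟩ := L.isClosed_lattice.isOpen_compl.exists_is_const_of_deriv_eq_zero
    (isPreconnected_compl_lattice L)
    (fun z hz => (hd z hz).differentiableAt.differentiableWithinAt) (fun z hz => (hd z hz).deriv)
  exact ⟨η, fun z hz => eq_add_of_sub_eq' (hη z hz)⟩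

/-- The quasi-period `η` with `ζ (z + l) = ζ z + η`. -/
noncomputable def quasiPeriod (l : L.lattice) : ℂ := (exists_weierstrassZeta_add L l).choose

theorem weierstrassZeta_add_coe (l : L.lattice) {z : ℂ} (hz : z ∉ L.lattice) :
    weierstrassZeta L (z + l) = weierstrassZeta L z + quasiPeriod L l :=
  (exists_weierstrassZeta_add L l).choose_spec z hz

/-- The function `(-1) ^ j / j ! * ζ^(j)`, with principal part `1 / (z - l) ^ (j + 1)` at every
lattice point `l`. -/
noncomputable def zetaKernel (j : ℕ) (z : ℂ) : ℂ := (-1) ^ j / (j ! : ℂ) * iteratedDeriv j (weierstrassZeta L) z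

theorem zetaKernel_zero : zetaKernel L 0 = weierstrassZeta L := by
  ext z
  simp [zetaKernel]

theorem zetaKernel_succ (j : ℕ) :
    zetaKernel L (j + 1) = fun z => -(1 / ((j : ℂ) + 1)) * deriv (zetaKernel L j) z := by
  ext z
  unfold zetaKernel
  rw [deriv_const_mul_field, iteratedDeriv_succ, Nat.factorial_succ]
  push_cast
  have : (j ! : ℂ) ≠ 0 := by exact_mod_cast j.factorial_ne_zero
  have : (j : ℂ) + 1 ≠ 0 := by exact_mod_cast j.succ_ne_zero
  field_simp
  ring

theorem analyticAt_zetaKernel (j : ℕ) {z : ℂ} (hz : z ∉ L.lattice) :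
    AnalyticAt ℂ (zetaKernel L j) z := by
  refine analyticAt_const.mul ?_
  rw [iteratedDeriv_eq_iterate]
  exact (analyticAt_weierstrassZeta L hz).iterated_deriv j

/-- Differentiation kills the additive quasi-period, so only `ζ` itself fails to be periodic. -/
theorem zetaKernel_add_coe (j : ℕ) (l : L.lattice) {z : ℂ} (hz : z ∉ L.lattice) :
    zetaKernel L j (z + l) = zetaKernel L j z + if j = 0 then quasiPeriod L l else 0 := by
  rcases j with _ | j
  · simp [zetaKernel_zero, weierstrassZeta_add_coe L l hz]
  · simp only [Nat.add_eq_zero_iff, one_ne_zero, and_false, if_false, add_zero]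
    unfold zetaKernel
    rw [← congr_fun (iteratedDeriv_comp_add_const (j + 1) (weierstrassZeta L) (l : ℂ)) z]
    have : (fun z => weierstrassZeta L (z + l)) =ᶠ[𝓝 z]
        fun z => weierstrassZeta L z + quasiPeriod L l := by
      filter_upwards [L.isClosed_lattice.isOpen_compl.mem_nhds hz] with w hw
      exact weierstrassZeta_add_coe L l hw
    rw [this.iteratedDeriv_eq, iteratedDeriv_fun_add
      (analyticAt_weierstrassZeta L hz).contDiffAt contDiffAt_const, iteratedDeriv_const]
    simp

theorem hasPrincipalPart_weierstrassZeta (l : L.lattice) :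
    HasPrincipalPart (weierstrassZeta L) l (Finsupp.single 0 1) := by
  have h : AnalyticAt ℂ (zetaExcept L l) l :=
    (differentiableOn_zetaExcept L l).analyticAt (L.compl_lattice_sdiff_singleton_mem_nhds l)
  refine ⟨fun z => zetaExcept L l z + (1 / (l : ℂ) + z / (l : ℂ) ^ 2), ?_, .of_eq ?_⟩
  · fun_prop
  · ext z
    rw [← zetaExcept_add L l z, Finsupp.sum_single_index (by simp)]
    ring

/-- Differentiating `1 / (z - l) ^ (j + 1)` produces the factor `-(j + 1)`, which the normalisation
in `zetaKernel_succ` removes. -/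
theorem hasPrincipalPart_zetaKernel (j : ℕ) (l : L.lattice) :
    HasPrincipalPart (zetaKernel L j) l (Finsupp.single j 1) := by
  induction j with
  | zero => simpa only [zetaKernel_zero] using hasPrincipalPart_weierstrassZeta L l
  | succ j ih =>
    obtain ⟨h, hh, e⟩ := ih
    refine ⟨fun z => -(1 / ((j : ℂ) + 1)) * deriv h z, analyticAt_const.mul hh.deriv, ?_⟩
    have e' := eventually_eventually_nhdsWithin.2 e
    filter_upwards [e', self_mem_nhdsWithin, hh.eventually_analyticAt.filter_mono
      nhdsWithin_le_nhds] with z hz hne hhz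
    have hne' : z - l ≠ 0 := sub_ne_zero.2 hne
    rw [eventually_nhdsWithin_iff] at hz
    have hz' : zetaKernel L j =ᶠ[𝓝 z] fun z => 1 / (z - l) ^ (j + 1) + h z := by
      filter_upwards [hz, isOpen_ne.mem_nhds hne] with w hw hwl
      rw [hw hwl, Finsupp.sum_single_index (by simp)]
    have hd : HasDerivAt (fun z : ℂ => 1 / (z - l) ^ (j + 1) + h z)
        (-((j : ℂ) + 1) / (z - l) ^ (j + 2) + deriv h z) z := by
      have h1 := ((((hasDerivAt_id z).sub_const (l : ℂ)).pow (j + 1)).inv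
        (pow_ne_zero _ hne')).add hhz.differentiableAt.hasDerivAt
      refine (h1.congr_deriv ?_).congr_of_eventuallyEq (.of_eq ?_)
      · simp only [id, Pi.pow_apply]
        push_cast
        congr 1
        field_simp
        ring
      · ext; simp
    simp only [zetaKernel_succ]
    rw [hz'.deriv_eq, hd.deriv, Finsupp.sum_single_index (by simp)]
    have : (j : ℂ) + 1 ≠ 0 := by exact_mod_cast j.succ_ne_zero
    field_simp
    ring

end WeierstrassZeta

/-! ### Removable singularities, Liouville arguments, and non-ellipticity of zeta. -/

section Liouville

theorem eventuallyEq_codiscrete_iff {f g : ℂ → ℂ} :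
    f =ᶠ[codiscrete ℂ] g ↔ ∀ x, f =ᶠ[𝓝[≠] x] g := by
  simp only [EventuallyEq, Filter.Eventually, mem_codiscrete, disjoint_principal_right, compl_compl]

theorem eq_of_eventuallyEq_codiscrete {f g : ℂ → ℂ} (hf : Continuous f) (hg : Continuous g)
    (h : f =ᶠ[codiscrete ℂ] g) : f = g := by
  ext x
  have h1 : Tendsto f (𝓝[≠] x) (𝓝 (f x)) := hf.continuousAt.tendsto.mono_left nhdsWithin_le_nhds
  have h2 : Tendsto g (𝓝[≠] x) (𝓝 (g x)) := hg.continuousAt.tendsto.mono_left nhdsWithin_le_nhds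
  exact tendsto_nhds_unique (h1.congr' (eventuallyEq_codiscrete_iff.1 h x)) h2

theorem eventuallyEq_codiscrete_comp_add_const {f g : ℂ → ℂ} (h : f =ᶠ[codiscrete ℂ] g) (s : ℂ) :
    (fun z => f (z + s)) =ᶠ[codiscrete ℂ] fun z => g (z + s) := by
  rw [eventuallyEq_codiscrete_iff] at *
  intro x
  have : Tendsto (fun z : ℂ => z + s) (𝓝[≠] x) (𝓝[≠] (x + s)) := map_add_right_nhdsNE.le
  exact this.eventually (h (x + s))

/-- A function all of whose singularities are removable agrees with an entire function. -/
theorem exists_differentiable_of_hasPrincipalPart_zero {f : ℂ → ℂ}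
    (hf : ∀ α, HasPrincipalPart f α 0) :
    ∃ H : ℂ → ℂ, Differentiable ℂ H ∧ f =ᶠ[codiscrete ℂ] H := by
  have hf' : ∀ α, ∃ h : ℂ → ℂ, AnalyticAt ℂ h α ∧ f =ᶠ[𝓝[≠] α] h := by
    intro α
    obtain ⟨h, hh, e⟩ := hf α
    exact ⟨h, hh, by simpa using e⟩
  choose h hh e using hf'
  -- The local extensions are glued along the diagonal: near `α`, both `h z` and `h α` have at `z`
  -- the limit of `f` as their value.
  have key : ∀ α, (fun z => h z z) =ᶠ[𝓝 α] h α := by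
    intro α
    have h1 := eventually_eventually_nhdsWithin.2 (e α)
    have h2 : ∀ᶠ z in 𝓝[≠] α, h z z = h α z := by
      filter_upwards [h1, (hh α).eventually_continuousAt.filter_mono nhdsWithin_le_nhds,
        self_mem_nhdsWithin] with z hz hc hne
      have h3 : f =ᶠ[𝓝[≠] z] h α := by
        rw [eventually_nhdsWithin_iff] at hz
        have : ∀ᶠ x in 𝓝 z, f x = h α x := by
          filter_upwards [hz, isOpen_ne.mem_nhds hne] with w hw hwa using hw hwa
        exact this.filter_mono nhdsWithin_le_nhds
      exact tendsto_nhds_unique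
        (((hh z).continuousAt.tendsto.mono_left nhdsWithin_le_nhds).congr' ((e z).symm.trans h3))
        (hc.tendsto.mono_left nhdsWithin_le_nhds)
    rw [eventually_nhdsWithin_iff] at h2
    filter_upwards [h2] with z hz
    by_cases hza : z = α
    · rw [hza]
    · exact hz hza
  refine ⟨fun z => h z z, fun α => ((hh α).congr (key α).symm).differentiableAt, ?_⟩
  rw [eventuallyEq_codiscrete_iff]
  exact fun α => (e α).trans ((key α).symm.filter_mono nhdsWithin_le_nhds)

variable (L : PeriodPair)

/-- Every complex number is congruent modulo the lattice to one of bounded norm. -/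
theorem exists_forall_lattice_sub_norm_le :
    ∃ B : ℝ, ∀ z : ℂ, ∃ l : L.lattice, ‖z - l‖ ≤ B := by
  refine ⟨∑ i, ‖L.basis i‖, fun z => ?_⟩
  refine ⟨⟨ZSpan.floor L.basis z, ?_⟩, ZSpan.norm_fract_le (K := ℝ) L.basis z⟩
  rw [L.lattice_eq_span_range_basis]
  exact (ZSpan.floor L.basis z).2

/-- Periodicity confines all values to the image of one compact ball, so Liouville's theorem
applies. -/
theorem eq_of_differentiable_of_periodic {H : ℂ → ℂ} (hH : Differentiable ℂ H)
    (hp : ∀ l : L.lattice, ∀ z, H (z + l) = H z) (z w : ℂ) : H z = H w := by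
  refine hH.apply_eq_apply_of_bounded ?_ z w
  obtain ⟨B, hB⟩ := exists_forall_lattice_sub_norm_le L
  refine (((isCompact_closedBall (0 : ℂ) B).image hH.continuous).isBounded).subset ?_
  rintro _ ⟨x, rfl⟩
  obtain ⟨l, hl⟩ := hB x
  refine ⟨x - l, by simpa using hl, ?_⟩
  rw [← hp l (x - l), sub_add_cancel]

/-- An entire function with constant differences along the lattice is affine. -/
theorem exists_affine_of_quasiPeriodic {H : ℂ → ℂ} (hH : Differentiable ℂ H) (κ : L.lattice → ℂ)
    (hp : ∀ l : L.lattice, ∀ z, H (z + l) = H z + κ l) :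
    ∃ A B : ℂ, ∀ z, H z = A * z + B := by
  have hd : Differentiable ℂ (deriv H) := fun z => (hH.analyticAt z).deriv.differentiableAt
  -- The derivative is entire and periodic, hence constant.
  have hdp : ∀ l : L.lattice, ∀ z, deriv H (z + l) = deriv H z := by
    intro l z
    rw [← deriv_comp_add_const H (l : ℂ) z, funext (hp l), deriv_add_const]
  refine ⟨deriv H 0, H 0, fun z => ?_⟩
  have h1 : ∀ z, HasDerivAt (fun z => H z - deriv H 0 * z) 0 z := by
    intro z
    have := (hH z).hasDerivAt.sub ((hasDerivAt_id z).const_mul (deriv H 0))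
    refine (this.congr_deriv ?_)
    rw [eq_of_differentiable_of_periodic L hd hdp z 0]
    ring
  have h2 := is_const_of_deriv_eq_zero (fun z => (h1 z).differentiableAt)
    (fun z => (h1 z).deriv) z 0
  linear_combination h2

theorem compl_lattice_mem_codiscrete : (L.lattice : Set ℂ)ᶜ ∈ codiscrete ℂ := by
  rw [mem_codiscrete']
  refine ⟨L.isClosed_lattice.isOpen_compl, ?_⟩
  rw [compl_compl]
  exact ⟨inferInstanceAs (DiscreteTopology L.lattice)⟩

/-- The Weierstrass zeta function does not become elliptic after adding a linear function. -/
theorem not_forall_quasiPeriod_eq_mul (a : ℂ) : ¬ ∀ l : L.lattice, quasiPeriod L l = a * l := by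
  intro hη
  -- If the quasi-periods were linear, `u` would be odd and elliptic with one simple pole modulo the
  -- lattice. Its zeros at half periods then make a product of two translates entire, hence
  -- constant, and that constant turns out to be zero.
  set u : ℂ → ℂ := fun z => weierstrassZeta L z - a * z with hu
  have hper : ∀ l : L.lattice, ∀ z ∉ L.lattice, u (z + l) = u z := by
    intro l z hz
    simp only [hu, weierstrassZeta_add_coe L l hz, hη]
    ring
  have hodd : ∀ z, u (-z) = -u z := by
    intro z
    simp only [hu, weierstrassZeta_neg]
    ring
  have han : ∀ z ∉ L.lattice, AnalyticAt ℂ u z := by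
    intro z hz
    have := analyticAt_weierstrassZeta L hz
    fun_prop
  have hpole : ∀ l : L.lattice, ∃ h : ℂ → ℂ, AnalyticAt ℂ h l ∧
      u =ᶠ[𝓝[≠] (l : ℂ)] fun z => 1 / (z - l) + h z := by
    intro l
    obtain ⟨h, hh, e⟩ := hasPrincipalPart_weierstrassZeta L l
    refine ⟨fun z => h z - a * z, by fun_prop, ?_⟩
    filter_upwards [e] with z hz
    simp only [hu, hz, Finsupp.sum_single_index, zero_div, zero_add, pow_one]
    ring
  -- Since `w` and `-w` are congruent, periodicity and oddness give `u w = -u w`.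
  have hhalf : ∀ w : ℂ, w ∉ L.lattice → 2 * w ∈ L.lattice → u w = 0 := by
    intro w hw h2w
    have h1 := hper ⟨2 * w, h2w⟩ (-w) (by simpa using hw)
    simp only [show -w + 2 * w = w by ring] at h1
    rw [hodd] at h1
    exact self_eq_neg.1 h1
  set w₁ := L.ω₁ / 2 with hw₁
  have hw₁m : w₁ ∉ L.lattice := L.ω₁_div_two_notMem_lattice
  have h2w₁ : 2 * w₁ ∈ L.lattice := by
    rw [hw₁, mul_div_cancel₀ _ two_ne_zero]
    exact L.ω₁_mem_lattice
  have hzero : ∀ l : L.lattice, ∀ ε : ℂ, ε = w₁ ∨ ε = -w₁ → u (l + ε) = 0 := by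
    intro l ε hε
    have hm : ε ∉ L.lattice := by rcases hε with rfl | rfl <;> simpa using hw₁m
    rw [add_comm, hper l ε hm]
    refine hhalf ε hm ?_
    rcases hε with rfl | rfl
    · exact h2w₁
    · simpa using h2w₁
  -- a simple pole times a zero is removable
  have hprod : ∀ (l : L.lattice) (k : ℂ → ℂ), AnalyticAt ℂ k l → k l = 0 →
      HasPrincipalPart (fun z => u z * k z) l 0 := by
    intro l k hk hk0
    obtain ⟨h, hh, e⟩ := hpole l
    obtain ⟨p, hp⟩ := hk
    have hs : AnalyticAt ℂ (dslope k l) l := ⟨_, hp.has_fpower_series_dslope_fslope⟩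
    have hk : AnalyticAt ℂ k l := ⟨p, hp⟩
    refine (AnalyticAt.hasPrincipalPart_zero (f := fun z => dslope k l z + h z * k z)
      (by fun_prop)).congr ?_
    filter_upwards [e, self_mem_nhdsWithin] with z hz hne
    have hne : z - l ≠ 0 := sub_ne_zero.2 hne
    have := sub_smul_dslope k (l : ℂ) z
    rw [smul_eq_mul, hk0, sub_zero] at this
    rw [hz]
    nth_rw 1 [← this]
    rw [← this]
    field_simp
  -- The simple poles of each factor lie at zeros of the other, since `u` vanishes at `w₁` and `-w₁`
  -- modulo the lattice.
  set v : ℂ → ℂ := fun z => u z * u (z - w₁) with hv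
  have hvan : ∀ z, z ∉ L.lattice → z - w₁ ∉ L.lattice → AnalyticAt ℂ v z := by
    intro z h1 h2
    exact (han z h1).mul ((han _ h2).fun_comp_of_eq (by fun_prop) rfl)
  have hvpp : ∀ α, HasPrincipalPart v α 0 := by
    intro α
    by_cases h1 : α ∈ L.lattice
    · refine hprod ⟨α, h1⟩ (fun z => u (z - w₁)) ?_ ?_
      · refine (han (α - w₁) fun h => hw₁m ?_).fun_comp_of_eq (by fun_prop) rfl
        simpa using sub_mem h1 h
      · simpa [sub_eq_add_neg] using hzero ⟨α, h1⟩ (-w₁) (Or.inr rfl)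
    · by_cases h2 : α - w₁ ∈ L.lattice
      · have h3 := hprod ⟨α - w₁, h2⟩ (fun z => u (z + w₁))
          ((han (α - w₁ + w₁) (by simpa using h1)).fun_comp_of_eq (by fun_prop) rfl)
          (hzero ⟨α - w₁, h2⟩ w₁ (Or.inl rfl))
        have h4 := HasPrincipalPart.comp_add_const (α := α) (-w₁) (by simpa using! h3)
        refine h4.congr (.of_eq ?_)
        ext z
        simp [hv, ← sub_eq_add_neg, mul_comm]
      · exact (hvan α h1 h2).hasPrincipalPart_zero
  obtain ⟨V, hV, hVv⟩ := exists_differentiable_of_hasPrincipalPart_zero hvpp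
  have hgood : ∀ᶠ z in codiscrete ℂ, z ∉ L.lattice := compl_lattice_mem_codiscrete L
  have hgood' : ∀ᶠ z in codiscrete ℂ, z - w₁ ∉ L.lattice := by
    classical
    -- The indicator function recasts membership as an equality of functions, which can be
    -- translated by `-w₁`.
    have : (fun z => (if z - w₁ ∈ L.lattice then 1 else 0 : ℂ)) =ᶠ[codiscrete ℂ] fun _ => 0 := by
      have h0 : (fun z => (if z ∈ L.lattice then 1 else 0 : ℂ)) =ᶠ[codiscrete ℂ] fun _ => 0 := by
        filter_upwards [hgood] with z hz using if_neg hz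
      simpa [sub_eq_add_neg] using eventuallyEq_codiscrete_comp_add_const h0 (-w₁)
    filter_upwards [this] with z hz
    simpa using hz
  have hVp : ∀ l : L.lattice, ∀ z, V (z + l) = V z := by
    intro l
    refine congr_fun (eq_of_eventuallyEq_codiscrete (f := fun z => V (z + l))
      (hV.continuous.comp (by fun_prop)) hV.continuous ?_)
    refine (eventuallyEq_codiscrete_comp_add_const hVv l).symm.trans (EventuallyEq.trans ?_ hVv)
    filter_upwards [hgood, hgood'] with z h1 h2
    simp only [hv]
    rw [hper l z h1, add_sub_right_comm, hper l _ h2]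
  set w₂ := L.ω₂ / 2 with hw₂
  have hw₂m : w₂ ∉ L.lattice := L.ω₂_div_two_notMem_lattice
  -- The two half periods are incongruent, so `v` is analytic at `w₂` and inherits the zero of its
  -- first factor there.
  have hw₂₁ : w₂ - w₁ ∉ L.lattice := by
    have := L.mul_ω₁_add_mul_ω₂_mem_lattice (α := -1 / 2) (β := 1 / 2)
    intro h
    have h' := this.1 (by
      convert h using 1
      rw [hw₁, hw₂]
      push_cast
      ring)
    norm_num at h'
  have hVw : V w₂ = 0 := by
    have h1 : v =ᶠ[𝓝 w₂] V :=
      (AnalyticAt.frequently_eq_iff_eventually_eq (hvan w₂ hw₂m hw₂₁) (hV.analyticAt w₂)).1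
        (eventuallyEq_codiscrete_iff.1 hVv w₂).frequently
    rw [← h1.eq_of_nhds]
    simp only [hv]
    rw [hhalf w₂ hw₂m, zero_mul]
    rw [hw₂, mul_div_cancel₀ _ two_ne_zero]
    exact L.ω₂_mem_lattice
  have hV0 : ∀ z, V z = 0 := fun z => (eq_of_differentiable_of_periodic L hV hVp z w₂).trans hVw
  have humero : MeromorphicOn u Set.univ := by
    intro z _
    by_cases hz : z ∈ L.lattice
    · obtain ⟨h, hh, e⟩ := hpole ⟨z, hz⟩
      refine MeromorphicAt.congr ?_ e.symm
      exact (MeromorphicAt.div (by fun_prop) (by fun_prop)).add hh.meromorphicAt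
    · exact (han z hz).meromorphicAt
  -- The pole at `0` prevents `u` from vanishing identically near `0`. By connectedness it then
  -- vanishes identically near no point, so the product `v` cannot be zero near `0`.
  have hord0 : meromorphicOrderAt u 0 ≠ ⊤ := by
    intro htop
    rw [meromorphicOrderAt_eq_top_iff] at htop
    obtain ⟨h, hh, e⟩ := hpole 0
    have hpp : HasPrincipalPart u 0 (Finsupp.single 0 1) :=
      ⟨h, by simpa using hh, by simpa using e⟩
    have hpp0 : HasPrincipalPart u 0 0 :=
      (analyticAt_const (v := (0 : ℂ))).hasPrincipalPart_zero.congr htop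
    have := (hpp.polarCoeff_eq 0).symm.trans (hpp0.polarCoeff_eq 0)
    simp at this
  have hord : ∀ x, meromorphicOrderAt u x ≠ ⊤ := fun x =>
    humero.meromorphicOrderAt_ne_top_of_isPreconnected isPreconnected_univ
      (Set.mem_univ 0) (Set.mem_univ x) hord0
  have hne : ∀ x, ∀ᶠ z in 𝓝[≠] x, u z ≠ 0 := fun x =>
    (meromorphicOrderAt_ne_top_iff_eventually_ne_zero (humero x trivial)).1 (hord x)
  have ht : Tendsto (fun z : ℂ => z + -w₁) (𝓝[≠] 0) (𝓝[≠] (0 + -w₁)) := map_add_right_nhdsNE.le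
  obtain ⟨z, h1, h2, h3⟩ := ((hne 0).and ((ht.eventually (hne _)).and
    (eventuallyEq_codiscrete_iff.1 hVv 0))).exists
  rw [hV0] at h3
  exact mul_ne_zero h1 (by simpa [← sub_eq_add_neg] using h2) h3

end Liouville

/-! ### Zeta expansions of elliptic functions relative to a pinning. -/

section ZetaExpansion

variable {L : PeriodPair} {s : ℂ} (R : AnalyticPinning L s)

/-- The indices `(ω, n, j)` standing for the pole of order `j + 1` at `q_ω + n s`. -/
abbrev PoleIndex (L : PeriodPair) (s : ℂ) : Type := Orbit L s × ℤ × ℕ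

/-- The point `q_ω + n s`. -/
noncomputable def pinnedPoint (ω : Orbit L s) (n : ℤ) : ℂ := R.rep ω + n * s

theorem intCast_mul_notMem_lattice (hs : s ∉ Submodule.span ℚ (L.lattice : Set ℂ)) {n : ℤ}
    (hn : n ≠ 0) : n * s ∉ L.lattice := by
  intro h
  refine hs ?_
  have h1 := Submodule.smul_mem _ ((n : ℚ)⁻¹) (Submodule.subset_span (R := ℚ) h)
  have hn' : (n : ℂ) ≠ 0 := by exact_mod_cast hn
  rwa [Rat.smul_def, Rat.cast_inv, Rat.cast_intCast, inv_mul_cancel_left₀ hn'] at h1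

theorem mk_pinnedPoint (ω : Orbit L s) (n : ℤ) :
    (QuotientAddGroup.mk (pinnedPoint R ω n) : Orbit L s) = ω := by
  nth_rw 2 [← R.mk_rep ω]
  rw [QuotientAddGroup.eq, orbitGroup]
  refine AddSubgroup.mem_sup_right (AddSubgroup.mem_zmultiples_iff.2 ⟨-n, ?_⟩)
  simp [pinnedPoint]

/-- Together with `exists_eq_pinnedPoint_add`, this makes the pinned points a system of
representatives of `ℂ` modulo the lattice. The hypothesis on `s` ensures that no nonzero multiple of
`s` is a lattice point. -/
theorem eq_of_pinnedPoint_sub_mem (hs : s ∉ Submodule.span ℚ (L.lattice : Set ℂ))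
    {ω ω' : Orbit L s} {n n' : ℤ} (h : pinnedPoint R ω n - pinnedPoint R ω' n' ∈ L.lattice) :
    ω = ω' ∧ n = n' := by
  have h1 : ω = ω' := by
    rw [← mk_pinnedPoint R ω n, ← mk_pinnedPoint R ω' n', eq_comm, QuotientAddGroup.eq, orbitGroup]
    refine AddSubgroup.mem_sup_left ?_
    rw [neg_add_eq_sub]
    exact h
  refine ⟨h1, ?_⟩
  subst h1
  by_contra hn
  refine intCast_mul_notMem_lattice hs (sub_ne_zero.2 hn) ?_
  convert h using 1
  simp [pinnedPoint]
  ring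

theorem exists_eq_add_of_mk_eq {α β : ℂ}
    (h : (QuotientAddGroup.mk α : Orbit L s) = QuotientAddGroup.mk β) :
    ∃ (m : ℤ) (l : L.lattice), β = α + m * s + l := by
  rw [QuotientAddGroup.eq, orbitGroup, AddSubgroup.mem_sup] at h
  obtain ⟨l, hl, y, hy, e⟩ := h
  obtain ⟨m, rfl⟩ := AddSubgroup.mem_zmultiples_iff.1 hy
  refine ⟨m, ⟨l, hl⟩, ?_⟩
  rw [zsmul_eq_mul] at e
  linear_combination -e

theorem exists_eq_pinnedPoint_add (α : ℂ) :
    ∃ (n : ℤ) (l : L.lattice), α = pinnedPoint R (QuotientAddGroup.mk α) n + l :=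
  exists_eq_add_of_mk_eq (R.mk_rep (QuotientAddGroup.mk α))

/-- The zeta expansion with prescribed coefficients. -/
noncomputable def zetaSum : (PoleIndex L s →₀ ℂ) →ₗ[ℂ] (ℂ → ℂ) :=
  Finsupp.linearCombination ℂ fun i z => zetaKernel L i.2.2 (z - pinnedPoint R i.1 i.2.1)

theorem zetaSum_single (i : PoleIndex L s) (a : ℂ) :
    zetaSum R (Finsupp.single i a) =
      a • fun z => zetaKernel L i.2.2 (z - pinnedPoint R i.1 i.2.1) := by
  rw [zetaSum, Finsupp.linearCombination_single]

theorem poleIndex_mk_injective (ω : Orbit L s) (n : ℤ) :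
    Function.Injective fun j : ℕ => ((ω, n, j) : PoleIndex L s) := by
  intro j j' h
  simpa using h

/-- The part of the coefficients that belongs to the point `q_ω + n s`. -/
noncomputable def coeffAt (ω : Orbit L s) (n : ℤ) : (PoleIndex L s →₀ ℂ) →ₗ[ℂ] (ℕ →₀ ℂ) :=
  Finsupp.lcomapDomain (fun j => (ω, n, j)) (poleIndex_mk_injective ω n)

theorem coeffAt_apply (ω : Orbit L s) (n : ℤ) (c : PoleIndex L s →₀ ℂ) (j : ℕ) :
    coeffAt ω n c j = c (ω, n, j) := rfl

/-- By linearity a single kernel suffices; it is singular only on the lattice coset of its own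
pinned point, and other pinned points avoid that coset. -/
theorem hasPrincipalPart_zetaSum (hs : s ∉ Submodule.span ℚ (L.lattice : Set ℂ))
    (c : PoleIndex L s →₀ ℂ) (ω : Orbit L s) (n : ℤ) (l : L.lattice) :
    HasPrincipalPart (zetaSum R c) (pinnedPoint R ω n + l) (coeffAt ω n c) := by
  induction c using Finsupp.induction_linear with
  | zero =>
    rw [map_zero, map_zero]
    exact (analyticAt_const (v := (0 : ℂ))).hasPrincipalPart_zero
  | add c d hc hd =>
    rw [map_add, map_add]
    exact hc.add hd
  | single i a =>
    classical
    obtain ⟨ω', n', j⟩ := i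
    rw [zetaSum_single]
    dsimp only
    by_cases h : ω' = ω ∧ n' = n
    · obtain ⟨rfl, rfl⟩ := h
      have h1 : coeffAt ω' n' (Finsupp.single (ω', n', j) a) = a • Finsupp.single j 1 := by
        ext k
        rw [coeffAt_apply, Finsupp.single_apply, Finsupp.smul_apply, Finsupp.single_apply]
        by_cases hjk : j = k <;> simp [hjk]
      rw [h1]
      refine HasPrincipalPart.const_smul ?_ a
      simp only [sub_eq_add_neg]
      refine HasPrincipalPart.comp_add_const _ ?_
      simpa using hasPrincipalPart_zetaKernel L j l
    · have h1 : coeffAt ω n (Finsupp.single (ω', n', j) a) = 0 := by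
        ext k
        rw [coeffAt_apply, Finsupp.single_apply, if_neg, Finsupp.zero_apply]
        intro e
        simp only [Prod.mk.injEq] at e
        exact h ⟨e.1, e.2.1⟩
      rw [h1, ← smul_zero a]
      refine HasPrincipalPart.const_smul (AnalyticAt.hasPrincipalPart_zero ?_) a
      refine (analyticAt_zetaKernel L j (z := pinnedPoint R ω n + l - pinnedPoint R ω' n')
        fun hm => h ?_).fun_comp_of_eq (by fun_prop) rfl
      obtain ⟨h2, h3⟩ := eq_of_pinnedPoint_sub_mem R hs (ω := ω) (ω' := ω') (n := n) (n' := n')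
        (by simpa [add_sub_right_comm] using sub_mem hm l.2)
      exact ⟨h2.symm, h3.symm⟩

theorem meromorphic_zetaSum (hs : s ∉ Submodule.span ℚ (L.lattice : Set ℂ))
    (c : PoleIndex L s →₀ ℂ) : Meromorphic (zetaSum R c) := by
  intro α
  obtain ⟨n, l, h⟩ := exists_eq_pinnedPoint_add R α
  rw [h]
  exact (hasPrincipalPart_zetaSum R hs c _ n l).meromorphicAt

/-- The sum of the coefficients of the simple poles. -/
noncomputable def totalResidue : (PoleIndex L s →₀ ℂ) →ₗ[ℂ] ℂ :=
  Finsupp.linearCombination ℂ fun i => if i.2.2 = 0 then 1 else 0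

theorem totalResidue_single (i : PoleIndex L s) (a : ℂ) :
    totalResidue (Finsupp.single i a) = if i.2.2 = 0 then a else 0 := by
  simp [totalResidue]

/-- Only the terms with `j = 0` have a quasi-period, so the total residue is the sole obstruction to
periodicity. -/
theorem zetaSum_add_coe (c : PoleIndex L s →₀ ℂ) (l : L.lattice) :
    (fun z => zetaSum R c (z + l)) =ᶠ[codiscrete ℂ]
      fun z => zetaSum R c z + totalResidue c * quasiPeriod L l := by
  induction c using Finsupp.induction_linear with
  | zero => simp [EventuallyEq.refl]
  | add c d hc hd =>
    filter_upwards [hc, hd] with z hc hd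
    simp only [map_add, Pi.add_apply] at hc hd ⊢
    rw [hc, hd]
    ring
  | single i a =>
    have h1 : (fun z => zetaKernel L i.2.2 (z + l)) =ᶠ[codiscrete ℂ]
        fun z => zetaKernel L i.2.2 z + if i.2.2 = 0 then quasiPeriod L l else 0 := by
      filter_upwards [compl_lattice_mem_codiscrete L] with z hz
      exact zetaKernel_add_coe L i.2.2 l hz
    filter_upwards [eventuallyEq_codiscrete_comp_add_const h1 (-pinnedPoint R i.1 i.2.1)] with z hz
    rw [zetaSum_single, totalResidue_single]
    simp only [Pi.smul_apply, smul_eq_mul, sub_eq_add_neg]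
    rw [add_right_comm, hz]
    split_ifs <;> ring

theorem hasPrincipalPart_add_lattice {f : ℂ → ℂ} (hf : IsElliptic L f) {α : ℂ} {c : ℕ →₀ ℂ}
    (h : HasPrincipalPart f α c) (l : L.lattice) : HasPrincipalPart f (α + l) c := by
  have h1 := HasPrincipalPart.comp_add_const (α := α + l) (f := f) (c := c) (-l) (by simpa using h)
  refine h1.congr (.of_eq ?_)
  ext z
  exact (hf.2 _ (neg_mem l.2) z).symm

theorem polarCoeff_add_lattice {f : ℂ → ℂ} (hf : IsElliptic L f) (α : ℂ) (l : L.lattice) (j : ℕ) :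
    polarCoeff f (α + l) (j + 1) = polarCoeff f α (j + 1) := by
  obtain ⟨c, hc⟩ := (hf.1 α).exists_hasPrincipalPart
  rw [hc.polarCoeff_eq, (hasPrincipalPart_add_lattice hf hc l).polarCoeff_eq]

theorem finite_not_analyticAt_inter_closedBall {f : ℂ → ℂ} (hf : Meromorphic f) (B : ℝ) :
    ({α | ¬ AnalyticAt ℂ f α} ∩ Metric.closedBall 0 B).Finite := by
  have h := (hf.meromorphicOn (s := Set.univ)).analyticAt_mem_codiscreteWithin
  obtain ⟨h1, h2⟩ := mem_codiscrete'.1 h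
  exact ((isCompact_closedBall (0 : ℂ) B).inter_left h1.isClosed_compl).finite
    (h2.mono Set.inter_subset_left)

/-- Lattice translation moves all pinned points into one ball, injectively because they are pairwise
incongruent. The ball contains finitely many singularities of `f`, each with finitely many polar
coefficients. -/
theorem finite_setOf_polarCoeff_ne_zero (hs : s ∉ Submodule.span ℚ (L.lattice : Set ℂ))
    {f : ℂ → ℂ} (hf : IsElliptic L f) :
    {i : PoleIndex L s | polarCoeff f (pinnedPoint R i.1 i.2.1) (i.2.2 + 1) ≠ 0}.Finite := by
  obtain ⟨B, hB⟩ := exists_forall_lattice_sub_norm_le L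
  choose l hl using hB
  let ψ : Orbit L s × ℤ → ℂ := fun p => pinnedPoint R p.1 p.2 - l (pinnedPoint R p.1 p.2)
  have hψ : Function.Injective ψ := by
    rintro ⟨ω, n⟩ ⟨ω', n'⟩ h
    have := eq_of_pinnedPoint_sub_mem R hs (ω := ω) (ω' := ω') (n := n) (n' := n') (by
      have h' := sub_mem (l (pinnedPoint R ω n)).2 (l (pinnedPoint R ω' n')).2
      convert h' using 1
      simp only [ψ] at h
      linear_combination h)
    exact Prod.ext this.1 this.2
  have hT := (finite_not_analyticAt_inter_closedBall hf.1 B).preimage hψ.injOn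
  have hj : ∀ p : Orbit L s × ℤ,
      {j : ℕ | polarCoeff f (pinnedPoint R p.1 p.2) (j + 1) ≠ 0}.Finite := by
    intro p
    obtain ⟨c, hc, hcj⟩ := (hf.1 (pinnedPoint R p.1 p.2)).hasPrincipalPart
    refine c.support.finite_toSet.subset fun j hj => ?_
    simpa [hcj] using hj
  refine (hT.biUnion fun p _ => (hj p).image fun j => ((p.1, p.2, j) : PoleIndex L s)).subset ?_
  rintro ⟨ω, n, j⟩ hi
  simp only [Set.mem_iUnion]
  refine ⟨(ω, n), ⟨fun han => hi ?_, ?_⟩, ⟨j, hi, rfl⟩⟩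
  · have h1 := polarCoeff_add_lattice hf (ψ (ω, n)) (l (pinnedPoint R ω n)) j
    simp only [ψ, sub_add_cancel] at h1
    dsimp only
    rw [h1, han.hasPrincipalPart_zero.polarCoeff_eq, Finsupp.zero_apply]
  · simpa using hl (pinnedPoint R ω n)

open Classical in
/-- The polar coefficients of an elliptic function at the pinned points. -/
noncomputable def polarData (f : ℂ → ℂ) : PoleIndex L s →₀ ℂ :=
  if h : {i : PoleIndex L s | polarCoeff f (pinnedPoint R i.1 i.2.1) (i.2.2 + 1) ≠ 0}.Finite then
    Finsupp.ofSupportFinite (fun i => polarCoeff f (pinnedPoint R i.1 i.2.1) (i.2.2 + 1)) h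
  else 0

theorem polarData_apply (hs : s ∉ Submodule.span ℚ (L.lattice : Set ℂ))
    {f : ℂ → ℂ} (hf : IsElliptic L f) (ω : Orbit L s) (n : ℤ) (j : ℕ) :
    polarData R f (ω, n, j) = polarCoeff f (pinnedPoint R ω n) (j + 1) := by
  rw [polarData, dif_pos (finite_setOf_polarCoeff_ne_zero R hs hf)]
  rfl

theorem hasPrincipalPart_polarData (hs : s ∉ Submodule.span ℚ (L.lattice : Set ℂ))
    {f : ℂ → ℂ} (hf : IsElliptic L f) (ω : Orbit L s) (n : ℤ) (l : L.lattice) :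
    HasPrincipalPart f (pinnedPoint R ω n + l) (coeffAt ω n (polarData R f)) := by
  obtain ⟨c, hc, hcj⟩ := (hf.1 (pinnedPoint R ω n)).hasPrincipalPart
  refine hasPrincipalPart_add_lattice hf ?_ l
  convert hc using 1
  ext j
  rw [coeffAt_apply, polarData_apply R hs hf, hcj]

/-- Uniqueness of the zeta expansion: the principal part at each pinned point determines the
coefficients. -/
theorem polarData_eq (hs : s ∉ Submodule.span ℚ (L.lattice : Set ℂ))
    {f : ℂ → ℂ} (hf : IsElliptic L f) {C : ℂ} {c : PoleIndex L s →₀ ℂ}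
    (h : f =ᶠ[codiscrete ℂ] fun z => C + zetaSum R c z) : polarData R f = c := by
  ext ⟨ω, n, j⟩
  have h1 := hasPrincipalPart_zetaSum R hs c ω n 0
  have h2 := (analyticAt_const (v := C)).hasPrincipalPart_zero.add h1
  simp only [ZeroMemClass.coe_zero, add_zero, zero_add] at h2
  rw [polarData_apply R hs hf, (h2.congr (eventuallyEq_codiscrete_iff.1 h _)).polarCoeff_eq,
    coeffAt_apply]

/-- The zeta expansion of an elliptic function, together with the vanishing of the sum of its
residues. -/
theorem exists_eq_const_add_zetaSum (hs : s ∉ Submodule.span ℚ (L.lattice : Set ℂ))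
    {f : ℂ → ℂ} (hf : IsElliptic L f) :
    (∃ C : ℂ, f =ᶠ[codiscrete ℂ] fun z => C + zetaSum R (polarData R f) z) ∧
      totalResidue (polarData R f) = 0 := by
  set c := polarData R f with hc
  -- With all principal parts cancelled, the difference extends to an entire function whose lattice
  -- increments are constant, hence to an affine one.
  have hpp : ∀ α, HasPrincipalPart (f - zetaSum R c) α 0 := by
    intro α
    obtain ⟨n, l, h⟩ := exists_eq_pinnedPoint_add R α
    rw [h]
    rw [← sub_self (coeffAt (QuotientAddGroup.mk α) n c)]
    exact (hasPrincipalPart_polarData R hs hf _ n l).sub (hasPrincipalPart_zetaSum R hs c _ n l)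
  obtain ⟨H, hH, e⟩ := exists_differentiable_of_hasPrincipalPart_zero hpp
  have hper : ∀ l : L.lattice, ∀ z, H (z + l) = H z + -(totalResidue c * quasiPeriod L l) := by
    intro l
    refine congr_fun (eq_of_eventuallyEq_codiscrete (f := fun z => H (z + l))
      (hH.continuous.comp (by fun_prop)) (hH.continuous.add continuous_const) ?_)
    filter_upwards [e, eventuallyEq_codiscrete_comp_add_const e (l : ℂ), zetaSum_add_coe R c l]
      with z h1 h2 h3
    rw [← h1, ← h2]
    simp only [Pi.sub_apply]
    rw [h3, hf.2 _ l.2]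
    ring
  obtain ⟨A, B, hAB⟩ := exists_affine_of_quasiPeriodic L hH _ hper
  have hA : ∀ l : L.lattice, A * l = -(totalResidue c * quasiPeriod L l) := by
    intro l
    have := hper l 0
    rw [hAB, hAB] at this
    linear_combination this
  -- A nonzero total residue would make the quasi-periods of `ζ` linear in `l`.
  have hres : totalResidue c = 0 := by
    by_contra hne
    refine not_forall_quasiPeriod_eq_mul L (-A / totalResidue c) fun l => ?_
    have := hA l
    field_simp
    linear_combination this
  refine ⟨⟨B, ?_⟩, hres⟩
  have hA0 : A = 0 := by
    have h1 := hA ⟨L.ω₁, L.ω₁_mem_lattice⟩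
    have h2 : L.ω₁ ≠ 0 := by simpa using L.indep.ne_zero 0
    rw [hres, zero_mul, neg_zero] at h1
    exact (mul_eq_zero.1 h1).resolve_right h2
  filter_upwards [e] with z hz
  rw [hAB, hA0, zero_mul, zero_add, Pi.sub_apply] at hz
  linear_combination hz

/-- `IsElliptic` asks for periodicity at every point, poles included. A meromorphic normal form is
determined at each point by its punctured germ, so periodicity off a discrete set becomes exact. -/
theorem exists_isElliptic_eventuallyEq {G : ℂ → ℂ} (hG : Meromorphic G)
    (hp : ∀ l : L.lattice, (fun z => G (z + l)) =ᶠ[codiscrete ℂ] G) :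
    ∃ g : ℂ → ℂ, IsElliptic L g ∧ g =ᶠ[codiscrete ℂ] G := by
  have hG' : MeromorphicOn G Set.univ := hG.meromorphicOn
  have hnf : MeromorphicNFOn (toMeromorphicNFOn G Set.univ) Set.univ :=
    meromorphicNFOn_toMeromorphicNFOn G Set.univ
  have he : toMeromorphicNFOn G Set.univ =ᶠ[codiscrete ℂ] G :=
    (toMeromorphicNFOn_eqOn_codiscrete hG').symm
  refine ⟨toMeromorphicNFOn G Set.univ, ⟨fun z => (hnf (Set.mem_univ z)).meromorphicAt, ?_⟩, he⟩
  intro l hl z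
  have h1 : (toMeromorphicNFOn G Set.univ ∘ fun x => x + l) =ᶠ[𝓝[≠] z]
      toMeromorphicNFOn G Set.univ :=
    eventuallyEq_codiscrete_iff.1
      ((eventuallyEq_codiscrete_comp_add_const he l).trans ((hp ⟨l, hl⟩).trans he.symm)) z
  have h2 := (meromorphicNFAt_comp_add_const_iff_meromorphicNFAt.2
    (hnf (Set.mem_univ (z + l)))).eventuallyEq_nhdsNE_iff_eventuallyEq_nhds (hnf (Set.mem_univ z))
  exact (h2.1 h1).eq_of_nhds

end ZetaExpansion

/-! ### Linear algebra of the shift on coefficient tables. -/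

section OrbitalSums

variable {L : PeriodPair} {s : ℂ}

/-- The effect of the shift `τ` on coefficients. -/
noncomputable def shiftIndex : (PoleIndex L s →₀ ℂ) →ₗ[ℂ] (PoleIndex L s →₀ ℂ) :=
  Finsupp.lmapDomain ℂ ℂ fun i => (i.1, i.2.1 - 1, i.2.2)

theorem shiftIndex_single (ω : Orbit L s) (n : ℤ) (j : ℕ) (a : ℂ) :
    shiftIndex (Finsupp.single ((ω, n, j) : PoleIndex L s) a) =
      Finsupp.single (ω, n - 1, j) a := by
  simp [shiftIndex]

theorem zetaSum_shiftIndex (R : AnalyticPinning L s) (c : PoleIndex L s →₀ ℂ) (z : ℂ) :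
    zetaSum R (shiftIndex c) z = zetaSum R c (z + s) := by
  induction c using Finsupp.induction_linear with
  | zero => simp
  | add c d hc hd => simp [hc, hd]
  | single i a =>
    obtain ⟨ω, n, j⟩ := i
    rw [shiftIndex_single, zetaSum_single, zetaSum_single]
    simp only [Pi.smul_apply, pinnedPoint]
    congr 2
    push_cast
    ring

/-- The sums of the coefficients over the points of each orbit. -/
noncomputable def orbitSum : (PoleIndex L s →₀ ℂ) →ₗ[ℂ] (Orbit L s × ℕ →₀ ℂ) :=
  Finsupp.lmapDomain ℂ ℂ fun i => (i.1, i.2.2)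

theorem orbitSum_single (ω : Orbit L s) (n : ℤ) (j : ℕ) (a : ℂ) :
    orbitSum (Finsupp.single ((ω, n, j) : PoleIndex L s) a) = Finsupp.single (ω, j) a := by
  simp [orbitSum]

theorem orbitSum_shiftIndex (c : PoleIndex L s →₀ ℂ) : orbitSum (shiftIndex c) = orbitSum c := by
  induction c using Finsupp.induction_linear with
  | zero => simp
  | add c d hc hd => simp [hc, hd]
  | single i a =>
    obtain ⟨ω, n, j⟩ := i
    rw [shiftIndex_single, orbitSum_single, orbitSum_single]

theorem finsum_eq_orbitSum (c : PoleIndex L s →₀ ℂ) (ω : Orbit L s) (j : ℕ) :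
    ∑ᶠ n : ℤ, c (ω, n, j) = orbitSum c (ω, j) := by
  have hinj : Function.Injective fun n : ℤ => ((ω, n, j) : PoleIndex L s) := by
    intro n n' h
    simpa using h
  have hfin : ∀ c : PoleIndex L s →₀ ℂ, Function.HasFiniteSupport fun n : ℤ => c (ω, n, j) :=
    fun c => (c.support.finite_toSet.preimage hinj.injOn).subset fun n hn => by simpa using hn
  induction c using Finsupp.induction_linear with
  | zero => simp
  | add c d hc hd =>
    simp only [Finsupp.add_apply, map_add]
    rw [finsum_add_distrib (hfin c) (hfin d), hc, hd]
  | single i a =>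
    classical
    obtain ⟨ω', n', j'⟩ := i
    rw [orbitSum_single, finsum_eq_single _ n']
    · simp only [Finsupp.single_apply, Prod.mk.injEq, true_and]
    · intro n hn
      rw [Finsupp.single_apply, if_neg]
      simp [hn.symm]

/-- The difference telescopes along the orbit, in either direction from `0`. -/
theorem exists_shiftIndex_sub_eq_single (ω : Orbit L s) (j : ℕ) (a : ℂ) (n : ℤ) :
    ∃ d : PoleIndex L s →₀ ℂ, shiftIndex d - d =
      Finsupp.single (ω, n, j) a - Finsupp.single (ω, 0, j) a := by
  induction n using Int.induction_on with
  | zero => exact ⟨0, by simp⟩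
  | succ n ih =>
    obtain ⟨d, hd⟩ := ih
    refine ⟨d - Finsupp.single (ω, (n : ℤ) + 1, j) a, ?_⟩
    rw [map_sub, shiftIndex_single, add_sub_cancel_right]
    linear_combination (norm := abel) hd
  | pred n ih =>
    obtain ⟨d, hd⟩ := ih
    refine ⟨d + Finsupp.single (ω, -(n : ℤ), j) a, ?_⟩
    rw [map_add, shiftIndex_single]
    linear_combination (norm := abel) hd

theorem exists_shiftIndex_sub_eq {c : PoleIndex L s →₀ ℂ} (hc : orbitSum c = 0) :
    ∃ d : PoleIndex L s →₀ ℂ, shiftIndex d - d = c := by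
  -- `ι` concentrates each orbit sum at `n = 0`; modulo shift differences every table equals such a
  -- concentrated one.
  let ι : (Orbit L s × ℕ →₀ ℂ) →ₗ[ℂ] (PoleIndex L s →₀ ℂ) :=
    Finsupp.lmapDomain ℂ ℂ fun p => (p.1, 0, p.2)
  have key : ∀ c : PoleIndex L s →₀ ℂ,
      ∃ d : PoleIndex L s →₀ ℂ, shiftIndex d - d = c - ι (orbitSum c) := by
    intro c
    induction c using Finsupp.induction_linear with
    | zero => exact ⟨0, by simp⟩
    | add c c' hc hc' =>
      obtain ⟨d, hd⟩ := hc
      obtain ⟨d', hd'⟩ := hc'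
      refine ⟨d + d', ?_⟩
      simp only [map_add]
      linear_combination (norm := abel) hd + hd'
    | single i a =>
      obtain ⟨ω, n, j⟩ := i
      obtain ⟨d, hd⟩ := exists_shiftIndex_sub_eq_single ω j a n
      exact ⟨d, by simpa [orbitSum_single, ι] using hd⟩
  simpa [hc] using key c

/-- The sum of the coefficients of the simple poles at `q_ω + n s`, weighted by `n`. -/
noncomputable def firstMoment : (PoleIndex L s →₀ ℂ) →ₗ[ℂ] ℂ :=
  Finsupp.linearCombination ℂ fun i => if i.2.2 = 0 then (i.2.1 : ℂ) else 0

/-- Each simple pole contributes its coefficient times `(n - 1) - n = -1`. -/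
theorem firstMoment_shiftIndex_sub (d : PoleIndex L s →₀ ℂ) :
    firstMoment (shiftIndex d - d) = -totalResidue d := by
  induction d using Finsupp.induction_linear with
  | zero => simp
  | add c d hc hd =>
    rw [map_sub] at hc hd
    simp only [map_add, map_sub]
    linear_combination hc + hd
  | single i a =>
    obtain ⟨ω, n, j⟩ := i
    rw [shiftIndex_single, totalResidue_single, map_sub]
    simp only [firstMoment, Finsupp.linearCombination_single]
    split_ifs <;> simp
    ring

theorem linearCombination_eq_finsum (c : PoleIndex L s →₀ ℂ) (v : PoleIndex L s → ℂ) :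
    Finsupp.linearCombination ℂ v c =
      ∑ᶠ (ω : Orbit L s) (n : ℤ) (j : ℕ), c (ω, n, j) * v (ω, n, j) := by
  have hsub : (Function.support fun i => c i * v i) ⊆ c.support := by
    intro i hi
    simp only [Function.mem_support] at hi
    simpa using left_ne_zero_of_mul hi
  rw [← finsum_curry₃ (fun i => c i * v i) (c.support.finite_toSet.subset hsub),
    finsum_eq_sum_of_support_subset _ hsub, Finsupp.linearCombination_apply]
  rfl

end OrbitalSums

/-! ### Orbital and panorbital residues in terms of coefficient tables. -/

section PanorbitalResidues

variable {L : PeriodPair} {s : ℂ} (R : AnalyticPinning L s)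

theorem pinnedZetaSum_eq (hs : s ∉ Submodule.span ℚ (L.lattice : Set ℂ))
    {f : ℂ → ℂ} (hf : IsElliptic L f)
    (z : ℂ) : pinnedZetaSum L s R f z = zetaSum R (polarData R f) z := by
  have h1 : zetaSum R (polarData R f) z = Finsupp.linearCombination ℂ
      (fun i : PoleIndex L s => zetaKernel L i.2.2 (z - pinnedPoint R i.1 i.2.1))
        (polarData R f) := by
    simp [zetaSum, Finsupp.linearCombination_apply, Finsupp.sum, Finset.sum_apply]
  rw [h1, linearCombination_eq_finsum, pinnedZetaSum]
  congr! 6 with ω n j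
  rw [polarData_apply R hs hf, zetaKernel, pinnedPoint, sub_sub]
  ring

theorem panorbitalResidueOne_eq (hs : s ∉ Submodule.span ℚ (L.lattice : Set ℂ))
    {f : ℂ → ℂ} (hf : IsElliptic L f) : panorbitalResidueOne L s R f = firstMoment (polarData R f) := by
  rw [firstMoment, linearCombination_eq_finsum, panorbitalResidueOne]
  congr! 4 with ω n
  rw [finsum_eq_single _ 0]
  · rw [polarData_apply R hs hf, if_pos rfl, mul_comm]
    rfl
  · intro j hj
    simp [hj]

theorem panorbitalResidueZero_eq (hs : s ∉ Submodule.span ℚ (L.lattice : Set ℂ))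
    {f : ℂ → ℂ} (hf : IsElliptic L f)
    {C : ℂ}
    (h : f =ᶠ[codiscrete ℂ] fun z => C + zetaSum R (polarData R f) z) :
    panorbitalResidueZero L s R f = C := by
  have hex : ∃ C : ℂ, f =ᶠ[codiscrete ℂ] fun z => C + pinnedZetaSum L s R f z :=
    ⟨C, by simpa only [pinnedZetaSum_eq R hs hf] using h⟩
  rw [panorbitalResidueZero, dif_pos hex]
  have h1 : f =ᶠ[codiscrete ℂ] fun z => hex.choose + zetaSum R (polarData R f) z := by
    filter_upwards [hex.choose_spec] with z hz
    rw [← pinnedZetaSum_eq R hs hf]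
    exact hz
  have h2 : (fun _ => hex.choose : ℂ → ℂ) = fun _ => C := by
    refine eq_of_eventuallyEq_codiscrete continuous_const continuous_const ?_
    filter_upwards [h, h1] with z h h1
    linear_combination h - h1
  exact congr_fun h2 0

/-- The representative `Quotient.out ω` differs from the pinned one by `m * s + l`: the multiple of
`s` reindexes the sum and periodicity absorbs `l`. -/
theorem orbitalResidue_eq (hs : s ∉ Submodule.span ℚ (L.lattice : Set ℂ))
    {f : ℂ → ℂ} (hf : IsElliptic L f)
    (ω : Orbit L s) (j : ℕ) :
    orbitalResidue L s f ω (j + 1) = orbitSum (polarData R f) (ω, j) := by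
  rw [← finsum_eq_orbitSum, orbitalResidue]
  obtain ⟨m, l, h⟩ := exists_eq_add_of_mk_eq (s := s) (L := L) (α := R.rep ω)
    (β := Quotient.out ω) ((R.mk_rep ω).trans (Quotient.out_eq ω).symm)
  rw [← finsum_comp_equiv (Equiv.addRight m) (f := fun n => polarData R f (ω, n, j))]
  congr! 2 with n
  rw [Equiv.coe_addRight, polarData_apply R hs hf,
    ← polarCoeff_add_lattice hf (pinnedPoint R ω (n + m)) l, h, pinnedPoint]
  congr 1
  push_cast
  ring

theorem forall_orbitalResidue_eq_zero_iff (hs : s ∉ Submodule.span ℚ (L.lattice : Set ℂ))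
    {f : ℂ → ℂ} (hf : IsElliptic L f) :
    (∀ (ω : Orbit L s) (j : ℕ), 1 ≤ j → orbitalResidue L s f ω j = 0) ↔
      orbitSum (polarData R f) = 0 := by
  constructor
  · intro h
    ext ⟨ω, j⟩
    rw [← orbitalResidue_eq R hs hf, h ω (j + 1) (by omega), Finsupp.zero_apply]
  · rintro h ω (_ | j) hj
    · omega
    · rw [orbitalResidue_eq R hs hf, h, Finsupp.zero_apply]

/-- The convention that the orbit of `0` is represented by `0` is what places translates of `ζ` by
multiples of `s` among the kernels of the expansion. -/
theorem zetaSum_single_zero (n : ℤ) (z : ℂ) :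
    zetaSum R (Finsupp.single (0, n, 0) 1) z = weierstrassZeta L (z - n * s) := by
  simp [zetaSum_single, zetaKernel_zero, pinnedPoint, R.rep_zero]

theorem polarData_of_summable (hs : s ∉ Submodule.span ℚ (L.lattice : Set ℂ))
    {f : ℂ → ℂ} (hf : IsElliptic L f)
    {g : ℂ → ℂ} (hg : IsElliptic L g) {a b : ℂ}
    (h : (fun z => f z - (tau s g z - g z)) =ᶠ[codiscrete ℂ]
      fun z => a + b * (weierstrassZeta L (z + s) - weierstrassZeta L z)) :
    ∃ x : PoleIndex L s →₀ ℂ, polarData R f = shiftIndex x - x ∧ totalResidue x = b ∧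
      f =ᶠ[codiscrete ℂ] fun z => a + zetaSum R (polarData R f) z := by
  obtain ⟨⟨D, hD⟩, hres⟩ := exists_eq_const_add_zetaSum R hs hg
  -- `x` is the table of `g + b * ζ`. The constant `D` of `g` drops out of the shift difference, and
  -- the total residue is `b` because that of `g` is zero.
  set x := polarData R g + b • Finsupp.single ((0, 0, 0) : PoleIndex L s) 1 with hx
  have he : f =ᶠ[codiscrete ℂ] fun z => a + zetaSum R (shiftIndex x - x) z := by
    filter_upwards [h, hD, eventuallyEq_codiscrete_comp_add_const hD s] with z h1 h2 h3
    rw [map_sub, Pi.sub_apply, zetaSum_shiftIndex, hx, map_add, map_smul]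
    simp only [Pi.add_apply, Pi.smul_apply, zetaSum_single_zero R, smul_eq_mul, Int.cast_zero,
      zero_mul, sub_zero]
    simp only [tau] at h1
    rw [h2, h3] at h1
    linear_combination h1
  have hc := polarData_eq R hs hf he
  refine ⟨x, hc, ?_, by rwa [hc]⟩
  rw [hx, map_add, hres, map_smul, totalResidue_single]
  simp

/-- If all orbital residues vanish, the elliptic summability problem is solvable up to a multiple
of `ζ (z - (n - 1) s) - ζ (z - n s)`. -/
theorem exists_isElliptic_of_orbitSum_eq_zero (hs : s ∉ Submodule.span ℚ (L.lattice : Set ℂ))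
    {f : ℂ → ℂ} (hf : IsElliptic L f)
    (h : orbitSum (polarData R f) = 0) (n : ℤ) :
    ∃ g : ℂ → ℂ, IsElliptic L g ∧
      (fun z => f z - (tau s g z - g z)) =ᶠ[codiscrete ℂ]
        fun z => panorbitalResidueZero L s R f - panorbitalResidueOne L s R f *
          (weierstrassZeta L (z + s - n * s) - weierstrassZeta L (z - n * s)) := by
  obtain ⟨⟨C, hC⟩, -⟩ := exists_eq_const_add_zetaSum R hs hf
  obtain ⟨d, hd⟩ := exists_shiftIndex_sub_eq h
  -- The zeta sum of `d` need not be periodic. Removing its total residue at the point `n * s` makes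
  -- it so, at the cost of a shift difference of `ζ(z - n * s)`.
  set x := d - totalResidue d • Finsupp.single ((0, n, 0) : PoleIndex L s) 1 with hx
  have hres : totalResidue x = 0 := by
    rw [hx, map_sub, map_smul, totalResidue_single]
    simp
  obtain ⟨g, hg, e⟩ := exists_isElliptic_eventuallyEq (L := L) (meromorphic_zetaSum R hs x)
    (fun l => by simpa [hres] using zetaSum_add_coe R x l)
  refine ⟨g, hg, ?_⟩
  rw [panorbitalResidueZero_eq R hs hf hC, panorbitalResidueOne_eq R hs hf]
  nth_rw 1 [← hd]
  rw [firstMoment_shiftIndex_sub]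
  filter_upwards [hC, e, eventuallyEq_codiscrete_comp_add_const e s] with z h1 h2 h3
  simp only [tau]
  rw [h1, h2, h3, ← hd, hx]
  simp only [map_sub, map_smul, Pi.sub_apply, Pi.smul_apply, zetaSum_shiftIndex,
    zetaSum_single_zero R, smul_eq_mul]
  ring

end PanorbitalResidues

end EllipticSummability

/-! ### The summability criterion. -/

open EllipticSummability
theorem mainTheorem5 (L : PeriodPair) (s : ℂ)
    (hs : s ∉ Submodule.span ℚ (L.lattice : Set ℂ))
    (R : AnalyticPinning L s) (f : ℂ → ℂ) (hf : IsElliptic L f) :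
    ((∃ g : ℂ → ℂ, IsElliptic L g ∧ ∃ a b : ℂ,
        (fun z => f z - (tau s g z - g z)) =ᶠ[codiscrete ℂ]
          fun z => a + b * (weierstrassZeta L (z + s) - weierstrassZeta L z)) ↔
      ∀ (ω : Orbit L s) (j : ℕ), 1 ≤ j → orbitalResidue L s f ω j = 0) ∧
    (∀ (g : ℂ → ℂ) (a b : ℂ), IsElliptic L g →
      ((fun z => f z - (tau s g z - g z)) =ᶠ[codiscrete ℂ]
          fun z => a + b * (weierstrassZeta L (z + s) - weierstrassZeta L z)) →
      a = panorbitalResidueZero L s R f ∧ b = -panorbitalResidueOne L s R f) ∧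
    ((∀ (ω : Orbit L s) (j : ℕ), 1 ≤ j → orbitalResidue L s f ω j = 0) →
      ∃ g : ℂ → ℂ, IsElliptic L g ∧
        (fun z => f z - (tau s g z - g z)) =ᶠ[codiscrete ℂ]
          fun z => panorbitalResidueZero L s R f + panorbitalResidueOne L s R f *
            (weierstrassZeta L (z - s) - weierstrassZeta L z)) := by
  rw [forall_orbitalResidue_eq_zero_iff R hs hf]
  refine ⟨⟨?_, fun h => ?_⟩, fun g a b hg h => ?_, fun h => ?_⟩
  · rintro ⟨g, hg, a, b, h⟩
    obtain ⟨x, hx, -, -⟩ := polarData_of_summable R hs hf hg h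
    rw [hx, map_sub, orbitSum_shiftIndex, sub_self]
  -- Placing the correction at `0` yields `ζ(z + s) - ζ(z)`.
  · obtain ⟨g, hg, e⟩ := exists_isElliptic_of_orbitSum_eq_zero R hs hf h 0
    refine ⟨g, hg, panorbitalResidueZero L s R f, -panorbitalResidueOne L s R f, ?_⟩
    simpa [sub_eq_add_neg] using e
  · obtain ⟨x, hx, hb, e⟩ := polarData_of_summable R hs hf hg h
    refine ⟨(panorbitalResidueZero_eq R hs hf e).symm, ?_⟩
    rw [panorbitalResidueOne_eq R hs hf, hx, firstMoment_shiftIndex_sub, hb, neg_neg]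
  -- Placing the correction at `s` yields `ζ(z) - ζ(z - s)`, whose reversal absorbs the minus sign.
  · obtain ⟨g, hg, e⟩ := exists_isElliptic_of_orbitSum_eq_zero R hs hf h 1
    refine ⟨g, hg, e.trans (.of_eq ?_)⟩
    ext z
    rw [Int.cast_one, one_mul, add_sub_cancel_right]
    ring
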